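/- Let $G$ be a finite simple undirected graph of order $n=|V(G)|$. Under the hopping color change rule, a blue vertex $v$ can force a white vertex $w$ to become blue if $v$ has not yet performed a force and every neighbor of $v$ is blue. For $B\subseteq V(G)$, a set of hopping forces of $B$ is the set $\mathcal F$ of forces $v\to w$ performed, one after another, when one starts with exactly the vertices of $B$ blue and applies the rule until no more forces are possible; $B$ is a hopping forcing set if for some such $\mathcal F$ all vertices end up blue, and $\mathrm H(G)$ is the least size of a hopping forcing set. Put $\mathcal F^{(0)}=B$, and for $t\ge 1$ let $\mathcal F^{(t)}$ be the set of vertices $w$ for which there is a force $v\to w$ in $\mathcal F$ that is allowed by the rule when exactly the vertices of $\bigcup_{i<t}\mathcal F^{(i)}$ are blue. Let $\mathrm{pt}_{\mathrm H}(G;\mathcal F)$ be the least $t$ with $\bigcup_{i\le t}\mathcal F^{(i)}=V(G)$, let $\mathrm{pt}_{\mathrm H}(G;B)=\min_{\mathcal F}\mathrm{pt}_{\mathrm H}(G;\mathcal F)$ over all sets $\mathcal F$ of hopping forces of $B$, and let $\mathrm{pt}_{\mathrm H}(G,k)=\min\{\mathrm{pt}_{\mathrm H}(G;B) : B\subseteq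 V(G),\ |B|=k\}$, where the minimum of an empty set is $\infty$. Define $$\mathrm{th}^*_{\mathrm H}(G)=\min_{\mathrm H(G)\le k<n} k\cdot \mathrm{pt}_{\mathrm H}(G,k),\qquad k_{\mathrm H}(G,p)=\min\{|B| : B\subseteq V(G),\ \mathrm{pt}_{\mathrm H}(G;B)=p\}.$$ Theorem. For every finite simple graph $G$ of order $n$, $\mathrm{th}^*_{\mathrm H}(G)$ is the least $k$ such that $\mathrm{pt}_{\mathrm H}(G,k)=1$; that is, $\mathrm{th}^*_{\mathrm H}(G)=k_{\mathrm H}(G,1)$ (all these values being $\infty$ if no such $k$ exists, for example if $G$ is complete). Moreover, $k_{\mathrm H}(G,1)\ge \frac n2$. -/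

import Mathlib

namespace Hopping

variable {V : Type*}

/-- The hopping color change rule. If exactly the vertices in `blue` are blue, and exactly the
vertices in `performed` have already performed a force, then `v` can force `w`: `v` is blue, `w` is
white, `v` has yet to perform a force, and each neighbor of `v` is blue. -/
def CanForce (G : SimpleGraph V) (blue performed : Set V) (v w : V) : Prop :=
  v ∈ blue ∧ w ∉ blue ∧ v ∉ performed ∧ ∀ u, G.Adj v u → u ∈ blue

/-- The blue vertices after performing the forces in the list `L` (a pair `(v, w)` stands for the
force `v → w`), starting with the initial blue set `B`. -/
def blueAfter (B : Finset V) (L : List (V × V)) : Set V :=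
  {w | w ∈ B ∨ ∃ v, (v, w) ∈ L}

/-- The vertices that perform a force in the list `L`. -/
def performedIn (L : List (V × V)) : Set V :=
  {v | ∃ w, (v, w) ∈ L}

/-- `L` is a chronological list of hopping forces of `B`: every force in `L` is allowed by the
hopping rule at the moment it is performed, and after `L` no more forces are possible. -/
structure IsChronologicalList (G : SimpleGraph V) (B : Finset V) (L : List (V × V)) : Prop where
  valid : ∀ (L₁ L₂ : List (V × V)) (v w : V), L = L₁ ++ (v, w) :: L₂ →
    CanForce G (blueAfter B L₁) (performedIn L₁) v w
  maximal : ∀ v w : V, ¬ CanForce G (blueAfter B L) (performedIn L) v w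

/-- `F` is a set of hopping forces of `B`: the unordered set of forces of some chronological
list. -/
def IsSetOfForces (G : SimpleGraph V) (B : Finset V) (F : Set (V × V)) : Prop :=
  ∃ L, IsChronologicalList G B L ∧ F = {f | f ∈ L}

/-- `B` is a hopping forcing set: the whole vertex set is a final coloring of `B`. -/
def IsForcingSet (G : SimpleGraph V) (B : Finset V) : Prop :=
  ∃ L, IsChronologicalList G B L ∧ blueAfter B L = Set.univ

/-- The hopping forcing number `H(G)`, the size of a minimum hopping forcing set. -/
noncomputable def forcingNumber (G : SimpleGraph V) : ℕ∞ :=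
  ⨅ (B : Finset V) (_ : IsForcingSet G B), (B.card : ℕ∞)

/-- The white vertices that can become blue simultaneously using the forces in `F`, when exactly the
vertices in `U` are blue. The forces in `F` already performed are those whose target is blue. -/
def newlyBlue (G : SimpleGraph V) (F : Set (V × V)) (U : Set V) : Set V :=
  {w | ∃ v, (v, w) ∈ F ∧ CanForce G U {x | ∃ y ∈ U, (x, y) ∈ F} v w}

/-- The vertices that are blue after `t` time steps, i.e. `⋃ i ≤ t, F^(i)`, where `F^(0) = B` and
`F^(t+1)` is the set of vertices that become blue in time step `t + 1` using `F`. -/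
def blueByTime (G : SimpleGraph V) (B : Finset V) (F : Set (V × V)) : ℕ → Set V
  | 0 => {v | v ∈ B}
  | t + 1 => blueByTime G B F t ∪ newlyBlue G F (blueByTime G B F t)

/-- The propagation time of the set of forces `F` of `B`: the smallest `t` such that all vertices
are blue after `t` time steps (`⊤` if there is none). -/
noncomputable def propTimeForces (G : SimpleGraph V) (B : Finset V) (F : Set (V × V)) : ℕ∞ :=
  ⨅ (t : ℕ) (_ : blueByTime G B F t = Set.univ), (t : ℕ∞)

/-- The hopping propagation time `pt_H(G; B)`, the minimum over all sets of hopping forces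
of `B`. -/
noncomputable def propTime (G : SimpleGraph V) (B : Finset V) : ℕ∞ :=
  ⨅ (F : Set (V × V)) (_ : IsSetOfForces G B F), propTimeForces G B F

/-- `pt_H(G, k)`, the minimum hopping propagation time over all vertex sets of size `k`. -/
noncomputable def propTimeOfSize (G : SimpleGraph V) (k : ℕ) : ℕ∞ :=
  ⨅ (B : Finset V) (_ : B.card = k), propTime G B

/-- `k_H(G, p)`, the least size of a vertex set with hopping propagation time `p` (`⊤` if there is
none). -/
noncomputable def leastSize (G : SimpleGraph V) (p : ℕ) : ℕ∞ :=
  ⨅ (B : Finset V) (_ : propTime G B = p), (B.card : ℕ∞)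

/-- The product hopping throttling number without initial cost,
`th_H^*(G) = min {k * pt_H(G, k) | H(G) ≤ k < |V(G)|}` (`⊤` if there is no such `k`). -/
noncomputable def productThrottling [Fintype V] (G : SimpleGraph V) : ℕ∞ :=
  ⨅ (k : ℕ) (_ : forcingNumber G ≤ k ∧ k < Fintype.card V), (k : ℕ∞) * propTimeOfSize G k

end Hopping

/-!
Fix a set of forces `F` of `B`, with `|B| = k`, and let `U t` be the set of vertices that are blue
after `t` time steps. Every vertex of `U (t + 1)` outside `B` is forced by a vertex of `U t`, and a
vertex forces at most once, so `U (t + 1) \ B` injects into `U t`. Hence `|U (t + 1)| ≤ |U t| + k`,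
and `|U t| ≤ k * (t + 1)` (`ncard_blueByTime_le`).

If `F` turns the whole graph blue at time `p + 1` and no earlier, then `U p` is a proper subset of
the vertices, and the forces of the last step show that its propagation time is `1`
(`propTime_eq_one_of_blueByTime_succ`). Since `|U p| ≤ k * (p + 1)`, every product `k * pt(G, k)` is
at least the size of a set with propagation time `1` (`exists_propTime_eq_one_of_propTime_le`). Such
a set is itself a proper forcing set whose product is its size, so the minimum of the products is
the least size of a set with propagation time `1`. The same bound at `t = 1` shows that `B` contains
at least half of the vertices when its propagation time is `1`.
-/

namespace Hopping

/-! ### Sets of forces and blue vertices over time -/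

/-- A vertex performs at most one force. -/
theorem IsSetOfForces.target_unique {V : Type*} {G : SimpleGraph V} {B : Finset V}
    {F : Set (V × V)} (hF : IsSetOfForces G B F) {v w w' : V} (h : (v, w) ∈ F)
    (h' : (v, w') ∈ F) : w = w' := by
  obtain ⟨L, hL, rfl⟩ := hF
  simp only [Set.mem_ofPred_eq] at h h'
  obtain ⟨L₁, L₂, rfl⟩ := List.append_of_mem h
  rcases List.mem_append.1 h' with h₁ | h₂
  · exact absurd ⟨w', h₁⟩ (hL.valid L₁ L₂ v w rfl).2.2.1
  rcases List.mem_cons.1 h₂ with h₂ | h₂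
  · exact (Prod.mk.inj h₂).2.symm
  obtain ⟨M₁, M₂, rfl⟩ := List.append_of_mem h₂
  have hv := (hL.valid (L₁ ++ (v, w) :: M₁) M₂ v w' (by simp)).2.2.1
  exact absurd ⟨w, by simp⟩ hv

theorem blueByTime_mono {V : Type*} (G : SimpleGraph V) (B : Finset V) (F : Set (V × V)) :
    Monotone (blueByTime G B F) :=
  monotone_nat_of_le_succ fun _ => Set.subset_union_left

theorem blueByTime_subset_blueAfter {V : Type*} (G : SimpleGraph V) (B : Finset V)
    (L : List (V × V)) (t : ℕ) : blueByTime G B {f | f ∈ L} t ⊆ blueAfter B L := by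
  induction t with
  | zero => exact fun v hv => Or.inl hv
  | succ t ih =>
    rintro w (hw | ⟨v, hv, -⟩)
    · exact ih hw
    · exact Or.inr ⟨v, hv⟩

/-- A vertex that is blue after `t + 1` steps is in `B` or was forced by a vertex that was blue
one step earlier. -/
theorem exists_force_of_mem_blueByTime_succ {V : Type*} {G : SimpleGraph V} {B : Finset V}
    {F : Set (V × V)} {t : ℕ} {w : V} (hw : w ∈ blueByTime G B F (t + 1)) (hB : w ∉ B) :
    ∃ v ∈ blueByTime G B F t, (v, w) ∈ F := by
  induction t with
  | zero =>
    rcases hw with hw | ⟨v, hv, hf⟩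
    · exact absurd hw hB
    · exact ⟨v, hf.1, hv⟩
  | succ t ih =>
    rcases hw with hw | ⟨v, hv, hf⟩
    · obtain ⟨v, hv, h⟩ := ih hw
      exact ⟨v, blueByTime_mono G B F (Nat.le_succ t) hv, h⟩
    · exact ⟨v, hf.1, hv⟩

theorem ncard_blueByTime_le {V : Type*} [Finite V] {G : SimpleGraph V} {B : Finset V}
    {F : Set (V × V)} (hF : IsSetOfForces G B F) (t : ℕ) :
    (blueByTime G B F t).ncard ≤ B.card * (t + 1) := by
  induction t with
  | zero =>
    have : blueByTime G B F 0 = (B : Set V) := rfl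
    simp [this]
  | succ t ih =>
    have key : (blueByTime G B F (t + 1) \ (B : Set V)).ncard ≤ (blueByTime G B F t).ncard := by
      have h : ∀ w : V, ∃ v, w ∈ blueByTime G B F (t + 1) \ (B : Set V) →
          v ∈ blueByTime G B F t ∧ (v, w) ∈ F := by
        intro w
        by_cases hw : w ∈ blueByTime G B F (t + 1) \ (B : Set V)
        · obtain ⟨v, hv⟩ := exists_force_of_mem_blueByTime_succ hw.1 hw.2
          exact ⟨v, fun _ => hv⟩
        · exact ⟨w, fun h => absurd h hw⟩
      choose s hs using h
      refine Set.ncard_le_ncard_of_injOn s (fun w hw => (hs w hw).1) ?_ (Set.toFinite _)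
      intro a ha b hb hab
      refine hF.target_unique (hs a ha).2 ?_
      rw [hab]
      exact (hs b hb).2
    have h := Set.ncard_le_ncard_sdiff_add_ncard (blueByTime G B F (t + 1)) (B : Set V)
      (Set.toFinite _)
    rw [Set.ncard_coe_finset] at h
    calc _ ≤ B.card * (t + 1) + B.card := by omega
      _ = _ := by ring

/-! ### Propagation times -/

theorem propTime_le_iff {V : Type*} {G : SimpleGraph V} {B : Finset V} {p : ℕ} :
    propTime G B ≤ p ↔ ∃ F, IsSetOfForces G B F ∧ blueByTime G B F p = Set.univ := by
  constructor
  · intro h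
    have h' : propTime G B < ((p + 1 : ℕ) : ℕ∞) :=
      h.trans_lt (Nat.cast_lt.2 (Nat.lt_succ_self p))
    simp only [propTime, propTimeForces, iInf_lt_iff] at h'
    obtain ⟨F, hF, t, ht, hlt⟩ := h'
    have htp : t ≤ p := Nat.lt_succ_iff.1 (Nat.cast_lt.1 hlt)
    exact ⟨F, hF, Set.univ_subset_iff.1 (ht ▸ blueByTime_mono G B F htp)⟩
  · rintro ⟨F, hF, h⟩
    exact (iInf₂_le F hF).trans (iInf₂_le p h)

theorem propTime_eq_zero_iff {V : Type*} {G : SimpleGraph V} {B : Finset V} :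
    propTime G B = 0 ↔ (B : Set V) = Set.univ := by
  have h := propTime_le_iff (G := G) (B := B) (p := 0)
  rw [Nat.cast_zero, nonpos_iff_eq_zero] at h
  rw [h]
  constructor
  · rintro ⟨F, -, hF⟩
    exact hF
  · intro hB
    refine ⟨{f | f ∈ ([] : List (V × V))}, ⟨[], ⟨by simp, ?_⟩, rfl⟩, hB⟩
    intro v w hf
    exact hf.2.1 (Or.inl (Finset.mem_coe.1 (hB ▸ Set.mem_univ w)))

theorem propTime_eq_one_iff {V : Type*} {G : SimpleGraph V} {B : Finset V} :
    propTime G B = 1 ↔ propTime G B ≤ 1 ∧ (B : Set V) ≠ Set.univ := by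
  rw [le_antisymm_iff, Order.one_le_iff_pos, pos_iff_ne_zero, Ne, propTime_eq_zero_iff]

theorem isForcingSet_of_propTime_le {V : Type*} {G : SimpleGraph V} {B : Finset V} {p : ℕ}
    (h : propTime G B ≤ p) : IsForcingSet G B := by
  obtain ⟨F, ⟨L, hL, rfl⟩, hF⟩ := propTime_le_iff.1 h
  exact ⟨L, hL, Set.univ_subset_iff.1 (hF ▸ blueByTime_subset_blueAfter G B L p)⟩

/-- If distinct vertices of `C` with all neighbors in `C` can be assigned to the vertices outside
`C`, then these vertices force everything in one step. -/
theorem propTime_le_one_of_injOn {V : Type*} [Finite V] {G : SimpleGraph V} {C : Finset V}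
    (s : V → V) (hs : ∀ w ∉ C, s w ∈ C ∧ ∀ u, G.Adj (s w) u → u ∈ C)
    (hinj : Set.InjOn s {w | w ∉ C}) : propTime G C ≤ (1 : ℕ) := by
  classical
  have := Fintype.ofFinite V
  obtain ⟨M, hM, hMC⟩ : ∃ M : List V, M.Nodup ∧ ∀ w, w ∈ M ↔ w ∉ C :=
    ⟨Cᶜ.toList, Finset.nodup_toList _, by simp⟩
  have hmem : ∀ v w, (v, w) ∈ M.map (fun w => (s w, w)) ↔ w ∉ C ∧ v = s w := by
    intro v w
    simp only [List.mem_map, Prod.mk.injEq, hMC]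
    constructor
    · rintro ⟨a, ha, rfl, rfl⟩
      exact ⟨ha, rfl⟩
    · rintro ⟨hw, rfl⟩
      exact ⟨w, hw, rfl, rfl⟩
  refine propTime_le_iff.2 ⟨{f | f ∈ M.map fun w => (s w, w)}, ⟨_, ⟨?_, ?_⟩, rfl⟩, ?_⟩
  · intro L₁ L₂ v w hL
    have hnodup : ((M.map fun w => (s w, w)).map Prod.snd).Nodup := by
      simpa [List.map_map, Function.comp_def] using hM
    have hvw := (hmem v w).1 (by rw [hL]; simp)
    obtain ⟨hw, rfl⟩ := hvw
    have hfresh : ∀ x, (x, w) ∉ L₁ := by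
      intro x hx
      rw [hL, List.map_append, List.map_cons] at hnodup
      exact (List.nodup_append.1 hnodup).2.2 w (List.mem_map.2 ⟨_, hx, rfl⟩) w
        List.mem_cons_self rfl
    refine ⟨Or.inl (hs w hw).1, ?_, ?_, fun u hu => Or.inl ((hs w hw).2 u hu)⟩
    · rintro (h | ⟨x, hx⟩)
      · exact hw h
      · exact hfresh x hx
    · rintro ⟨y, hy⟩
      have hy' := (hmem (s w) y).1 (by rw [hL]; simp [hy])
      have hwy : w = y := hinj hw hy'.1 hy'.2
      subst hwy
      exact hfresh _ hy
  · intro v w hf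
    by_cases hw : w ∈ C
    · exact hf.2.1 (Or.inl hw)
    · exact hf.2.1 (Or.inr ⟨s w, (hmem _ _).2 ⟨hw, rfl⟩⟩)
  · refine Set.eq_univ_of_forall fun w => ?_
    by_cases hw : w ∈ C
    · exact Or.inl hw
    · refine Or.inr ⟨s w, (hmem _ _).2 ⟨hw, rfl⟩, (hs w hw).1, hw, ?_, (hs w hw).2⟩
      rintro ⟨y, hy, hy'⟩
      exact ((hmem _ _).1 hy').1 hy

/-- The set of vertices that are blue just before the last time step has propagation time `1`. -/
theorem propTime_eq_one_of_blueByTime_succ {V : Type*} [Finite V] {G : SimpleGraph V}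
    {B C : Finset V} {F : Set (V × V)} (hF : IsSetOfForces G B F) {p : ℕ}
    (hC : (C : Set V) = blueByTime G B F p) (hne : blueByTime G B F p ≠ Set.univ)
    (h : blueByTime G B F (p + 1) = Set.univ) : propTime G C = 1 := by
  refine propTime_eq_one_iff.2 ⟨?_, hC ▸ hne⟩
  have hmem : ∀ w, w ∈ C ↔ w ∈ blueByTime G B F p := fun w => by rw [← hC, Finset.mem_coe]
  have hex : ∀ w, ∃ v, w ∉ C → (v, w) ∈ F ∧ v ∈ C ∧ ∀ u, G.Adj v u → u ∈ C := by
    intro w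
    rcases (h ▸ Set.mem_univ w : w ∈ blueByTime G B F (p + 1)) with hw | ⟨v, hv, hf⟩
    · exact ⟨w, fun hw' => absurd ((hmem w).2 hw) hw'⟩
    · exact ⟨v, fun _ => ⟨hv, (hmem v).2 hf.1, fun u hu => (hmem u).2 (hf.2.2.2 u hu)⟩⟩
  choose s hs using hex
  refine mod_cast propTime_le_one_of_injOn s (fun w hw => (hs w hw).2) fun a ha b hb hab => ?_
  refine hF.target_unique (hs a ha).1 ?_
  rw [hab]
  exact (hs b hb).1

/-- A proper subset with propagation time at most `p` yields a set with propagation time `1` that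
is at most `p` times as large. -/
theorem exists_propTime_eq_one_of_propTime_le {V : Type*} [Finite V] {G : SimpleGraph V}
    {B : Finset V} (hB : (B : Set V) ≠ Set.univ) {p : ℕ} (hp : propTime G B ≤ p) :
    ∃ C : Finset V, propTime G C = 1 ∧ C.card ≤ B.card * p := by
  classical
  obtain ⟨F, hF, hex⟩ := propTime_le_iff.1 hp
  -- The last step is found as the first time at which all vertices are blue.
  have hex' : ∃ t, blueByTime G B F t = Set.univ := ⟨p, hex⟩
  have hle : Nat.find hex' ≤ p := Nat.find_min' hex' hex
  have hspec := Nat.find_spec hex'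
  have hmin := fun m => Nat.find_min hex' (m := m)
  generalize Nat.find hex' = t at hle hspec hmin
  cases t with
  | zero => exact absurd hspec hB
  | succ t =>
    have hC := (Set.toFinite (blueByTime G B F t)).coe_toFinset
    refine ⟨_, propTime_eq_one_of_blueByTime_succ hF hC (hmin t (Nat.lt_succ_self t)) hspec, ?_⟩
    rw [← Set.ncard_coe_finset, hC]
    exact (ncard_blueByTime_le hF t).trans (Nat.mul_le_mul_left _ hle)

/-! ### Minima over vertex sets -/

theorem exists_propTime_le_of_propTimeOfSize_le {V : Type*} {G : SimpleGraph V} {k p : ℕ}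
    (h : propTimeOfSize G k ≤ p) : ∃ B : Finset V, B.card = k ∧ propTime G B ≤ p := by
  have h' : propTimeOfSize G k < ((p + 1 : ℕ) : ℕ∞) :=
    h.trans_lt (Nat.cast_lt.2 (Nat.lt_succ_self p))
  simp only [propTimeOfSize, iInf_lt_iff] at h'
  obtain ⟨B, hB, hlt⟩ := h'
  refine ⟨B, hB, ?_⟩
  rw [Nat.cast_add, Nat.cast_one] at hlt
  exact Order.le_of_lt_add_one hlt

theorem coe_ne_univ_iff_card_lt {V : Type*} [Fintype V] {B : Finset V} :
    (B : Set V) ≠ Set.univ ↔ B.card < Fintype.card V := by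
  rw [Finset.card_lt_iff_ne_univ, Ne, Ne, Finset.coe_eq_univ]

theorem propTimeOfSize_eq_one_iff {V : Type*} [Fintype V] {G : SimpleGraph V} {k : ℕ} :
    propTimeOfSize G k = 1 ↔ ∃ B : Finset V, B.card = k ∧ propTime G B = 1 := by
  constructor
  · intro h
    obtain ⟨B, hB, hle⟩ := exists_propTime_le_of_propTimeOfSize_le (p := 1) (mod_cast h.le)
    exact ⟨B, hB, le_antisymm (mod_cast hle) (h ▸ iInf₂_le B hB)⟩
  · rintro ⟨B, hB, h⟩
    refine le_antisymm (h ▸ iInf₂_le B hB) (le_iInf₂ fun C hC => ?_)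
    have hlt := coe_ne_univ_iff_card_lt.1 (propTime_eq_one_iff.1 h).2
    rw [Order.one_le_iff_pos, pos_iff_ne_zero, Ne, propTime_eq_zero_iff]
    exact coe_ne_univ_iff_card_lt.2 (by omega)

theorem iInf_propTimeOfSize_eq_one {V : Type*} [Fintype V] (G : SimpleGraph V) :
    (⨅ (k : ℕ) (_ : propTimeOfSize G k = 1), (k : ℕ∞)) = leastSize G 1 := by
  refine le_antisymm (le_iInf₂ fun B hB => ?_) (le_iInf₂ fun k hk => ?_)
  · exact iInf₂_le B.card (propTimeOfSize_eq_one_iff.2 ⟨B, rfl, mod_cast hB⟩)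
  · obtain ⟨B, rfl, hB⟩ := propTimeOfSize_eq_one_iff.1 hk
    exact iInf₂_le B (mod_cast hB)

theorem IsForcingSet.nonempty {V : Type*} [Nonempty V] {G : SimpleGraph V} {B : Finset V}
    (h : IsForcingSet G B) : B.Nonempty := by
  obtain ⟨L, hL, huniv⟩ := h
  rw [Finset.nonempty_iff_ne_empty]
  rintro rfl
  cases L with
  | nil =>
    have hx := huniv ▸ Set.mem_univ (Classical.arbitrary V)
    simp [blueAfter] at hx
  | cons f L =>
    have hv := (hL.valid [] L f.1 f.2 rfl).1
    simp [blueAfter] at hv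

theorem forcingNumber_pos {V : Type*} [Nonempty V] (G : SimpleGraph V) : 0 < forcingNumber G := by
  rw [← Order.one_le_iff_pos]
  exact le_iInf₂ fun B hB => mod_cast hB.nonempty.card_pos

theorem productThrottling_eq_leastSize_one {V : Type*} [Fintype V] (G : SimpleGraph V) :
    productThrottling G = leastSize G 1 := by
  refine le_antisymm (le_iInf₂ fun B hB => ?_) (le_iInf₂ fun k hk => ?_)
  · have hB : propTime G B = 1 := mod_cast hB
    have hforce : IsForcingSet G B := isForcingSet_of_propTime_le (p := 1) (mod_cast hB.le)
    refine (iInf₂_le B.card ⟨iInf₂_le B hforce,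
      coe_ne_univ_iff_card_lt.1 (propTime_eq_one_iff.1 hB).2⟩).trans_eq ?_
    rw [propTimeOfSize_eq_one_iff.2 ⟨B, rfl, hB⟩, mul_one]
  · obtain ⟨hk, hlt⟩ := hk
    have : Nonempty V := Fintype.card_pos_iff.1 (by omega)
    cases hp : propTimeOfSize G k with
    | top =>
      -- `k` is positive, which excludes the product `0 * ⊤ = 0`.
      rw [ENat.mul_top ((forcingNumber_pos G).trans_le hk).ne']
      exact le_top
    | coe p =>
      obtain ⟨B, rfl, hB⟩ := exists_propTime_le_of_propTimeOfSize_le hp.le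
      obtain ⟨C, hC, hle⟩ :=
        exists_propTime_eq_one_of_propTime_le (coe_ne_univ_iff_card_lt.2 hlt) hB
      exact (iInf₂_le C (mod_cast hC)).trans (mod_cast hle)

theorem card_le_two_mul_card {V : Type*} [Fintype V] {G : SimpleGraph V} {B : Finset V}
    (h : propTime G B ≤ (1 : ℕ)) : Fintype.card V ≤ 2 * B.card := by
  obtain ⟨F, hF, huniv⟩ := propTime_le_iff.1 h
  have hcard := ncard_blueByTime_le hF 1
  rw [huniv, Set.ncard_univ, Nat.card_eq_fintype_card] at hcard
  omega

theorem card_le_two_mul_leastSize_one {V : Type*} [Fintype V] (G : SimpleGraph V) :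
    (Fintype.card V : ℕ∞) ≤ 2 * leastSize G 1 := by
  cases hm : leastSize G 1 with
  | top => simp
  | coe m =>
    have hlt : leastSize G 1 < ((m + 1 : ℕ) : ℕ∞) :=
      hm ▸ Nat.cast_lt.2 (Nat.lt_succ_self m)
    simp only [leastSize, iInf_lt_iff] at hlt
    obtain ⟨B, hB, hlt⟩ := hlt
    have hBm : B.card < m + 1 := Nat.cast_lt.1 hlt
    have := card_le_two_mul_card hB.le
    exact_mod_cast (by omega : Fintype.card V ≤ 2 * m)

end Hopping

theorem mainTheorem3 {V : Type*} [Fintype V] (G : SimpleGraph V) :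
    Hopping.productThrottling G =
        (⨅ (k : ℕ) (_ : Hopping.propTimeOfSize G k = 1), (k : ℕ∞)) ∧
      Hopping.productThrottling G = Hopping.leastSize G 1 ∧
      (Fintype.card V : ℕ∞) ≤ 2 * Hopping.leastSize G 1 :=
  ⟨(Hopping.productThrottling_eq_leastSize_one G).trans
      (Hopping.iInf_propTimeOfSize_eq_one G).symm,
    Hopping.productThrottling_eq_leastSize_one G, Hopping.card_le_two_mul_leastSize_one G⟩
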